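/- Let $G$ be a locally compact Hausdorff abelian group, written additively, with Haar measure $\lambda_G$ (a nonzero translation-invariant Radon measure). A function $f:G\to\mathbb{R}$ is called positive definite if $\sum_{i=1}^n\sum_{j=1}^n c_i\overline{c_j}f(g_i-g_j)\ge 0$ for all $n\in\mathbb{N}$, $c_1,\dots,c_n\in\mathbb{C}$ and $g_1,\dots,g_n\in G$ (in particular, these sums are real). A subset $\Omega$ of $G$ is called symmetric if $-\Omega=\Omega$, and boundary-coherent if $\partial\Omega\subset\overline{G\setminus\overline{\Omega}}$. For $\Omega_+,\Omega_-\subset G$ let $\mathcal{F}_G(\Omega_+,\Omega_-)$ be the set of all continuous positive definite functions $f:G\to\mathbb{R}$ that are integrable with respect to $\lambda_G$ and satisfy $f(0)=1$, $\{x\in G: f(x)>0\}\subset\Omega_+$ and $\{x\in G: f(x)<0\}\subset\Omega_-$. Put $$\mathcal{C}_G(\Omega_+,\Omega_-):=\sup_{f\in\mathcal{F}_G(\Omega_+,\Omega_-)}\int_G f\,d\lambda_G$$ (with the value $0$ if $\mathcal{F}_G(\Omega_+,\Omega_-)$ is empty). Theorem. Let $\Omega_+$ and $\Omega_-$ be symmetric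 boundary-coherent subsets of $G$, where $\Omega_+$ is a neighbourhood of $0$ of finite Haar measure. Then $\mathcal{C}_G(\Omega_+,\Omega_-)$ is finite and there exists $f\in\mathcal{F}_G(\Omega_+,\Omega_-)$ with $\int_G f\,d\lambda_G=\mathcal{C}_G(\Omega_+,\Omega_-)$. -/

import Mathlib

open MeasureTheory Topology

/-- A subset `Ω` of a topological space is boundary-coherent if its boundary is contained in the
closure of its exterior, the exterior being the complement of the closure. -/
def BoundaryCoherent {X : Type*} [TopologicalSpace X] (Ω : Set X) : Prop :=
  frontier Ω ⊆ closure (closure Ω)ᶜ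

section

open scoped ComplexOrder

/-- A function `f : G → ℂ` is positive definite if `∑ i, ∑ j, c i * conj (c j) * f (g i - g j)` is
real and nonnegative for all finite families of scalars `c i ∈ ℂ` and points `g i ∈ G`. (The order
on `ℂ` used here is the one in which `0 ≤ z` means that `z` is real and nonnegative.) -/
def IsPositiveDefinite {G : Type*} [AddGroup G] (f : G → ℂ) : Prop :=
  ∀ (n : ℕ) (c : Fin n → ℂ) (g : Fin n → G),
    0 ≤ ∑ i, ∑ j, c i * (starRingEnd ℂ) (c j) * f (g i - g j)

end

/-- The continuous positive definite real-valued functions `f` on `G` with `f 0 = 1`. -/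
def posDefOne (G : Type*) [AddGroup G] [TopologicalSpace G] : Set (G → ℝ) :=
  {f | Continuous f ∧ IsPositiveDefinite (fun x => (f x : ℂ)) ∧ f 0 = 1}

/-- The integrable functions in `posDefOne G` that are positive only on `Ωp` and negative only
on `Ωm`. -/
def extremalClass {G : Type*} [AddGroup G] [TopologicalSpace G] [MeasurableSpace G]
    (μ : Measure G) (Ωp Ωm : Set G) : Set (G → ℝ) :=
  {f | f ∈ posDefOne G ∧ Integrable f μ ∧ {x | 0 < f x} ⊆ Ωp ∧ {x | f x < 0} ⊆ Ωm}

/-- The supremum of the integrals of the functions in `extremalClass μ Ωp Ωm`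
(`0` if that class is empty). -/
noncomputable def extremalValue {G : Type*} [AddGroup G] [TopologicalSpace G] [MeasurableSpace G]
    (μ : Measure G) (Ωp Ωm : Set G) : ℝ :=
  sSup ((fun f : G → ℝ => ∫ x, f x ∂μ) '' extremalClass μ Ωp Ωm)

open scoped InnerProductSpace Pointwise

set_option linter.unusedSectionVars false

/-! The extremiser is a weak limit of an extremising sequence, and two things must be shown: the
limit has a continuous positive definite representative, and no integral is lost on the way.

Continuity. Each positive definite `f` is a Gram kernel `⟪e x, e y⟫ = f (x - y)` in a Hilbert space
(`IsRealPosDef.exists_inner_eq`). Smoothing `f` with an autocorrelation replaces `e x` by an average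
of its translates, so positive definiteness survives, and expanding one averaged square shows that a
smoothing close to `f 0` at `x` forces `f x` to be close to `f 0`
(`IsRealPosDef.smoothing_autocorrelation`). Let `M` be the supremum, over mollifiers, of the
limiting values at `0` of the smoothed sequence. A mollifier that nearly attains `M`, compared with
any much finer one, shows that fine smoothings are equicontinuous at `0` (`smoothing_zero_sub_le`).
They therefore converge locally uniformly (`exists_isRealPosDef_limit`), and as the mollifiers
shrink the limit `F` is also the weak limit of the unsmoothed sequence
(`exists_isRealPosDef_weak_limit`). Some mass at `0` may vanish, so only `F 0 ≤ 1` is known.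

Integral. Testing `f` against a cutoff equal to `1` on `K` can lose at most the measure of `interior
Ωp \ K`, because `f ≤ 1` and `f` is positive only there (`integral_sub_le_integral_mul`). This bound
is uniform along the sequence and, by finiteness of the measure and regularity, small for suitable
compact `K`; negative mass escaping to infinity only helps. Hence `F` is integrable with integral at
least the extremal value.

Sign conditions pass to the limit on the open exteriors, and boundary coherence with continuity
extends them to the full complements. The extremal value is positive, so `F 0 > 0`, and dividing by
`F 0 ≤ 1` does not decrease the integral. -/

/-- A real function that is even and all of whose quadratic forms
`∑ i, ∑ j, c i * c j * f (g i - g j)` with real coefficients are nonnegative. -/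
def IsRealPosDef {G : Type*} [AddGroup G] (f : G → ℝ) : Prop :=
  (∀ x, f (-x) = f x) ∧
    ∀ (n : ℕ) (c : Fin n → ℝ) (g : Fin n → G), 0 ≤ ∑ i, ∑ j, c i * c j * f (g i - g j)

/-! ### Complex versus real positive definiteness -/

section

open scoped ComplexOrder

theorem IsPositiveDefinite.isRealPosDef {G : Type*} [AddGroup G] {f : G → ℝ}
    (hf : IsPositiveDefinite (fun x => (f x : ℂ))) : IsRealPosDef f := by
  refine ⟨fun x => ?_, fun n c g => ?_⟩
  -- With coefficients `1, i` at the points `x, 0` the imaginary part of the form is `f (-x) - f x`.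
  · have h := (Complex.nonneg_iff.mp (hf 2 ![1, Complex.I] ![x, 0])).2
    simp [Fin.sum_univ_two] at h
    linarith
  · have h := hf n (fun i => (c i : ℂ)) g
    have h2 : (∑ i, ∑ j, (c i : ℂ) * (starRingEnd ℂ) (c j : ℂ) * (f (g i - g j) : ℂ)) =
        ((∑ i, ∑ j, c i * c j * f (g i - g j) : ℝ) : ℂ) := by
      push_cast
      simp
    rw [h2] at h
    exact_mod_cast h

theorem IsRealPosDef.isPositiveDefinite {G : Type*} [AddGroup G] {f : G → ℝ}
    (hf : IsRealPosDef f) : IsPositiveDefinite (fun x => (f x : ℂ)) := by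
  intro n c g
  rw [Complex.nonneg_iff]
  simp only [Complex.re_sum, Complex.im_sum]
  constructor
  · have h1 := hf.2 n (fun i => (c i).re) g
    have h2 := hf.2 n (fun i => (c i).im) g
    refine (add_nonneg h1 h2).trans_eq ?_
    simp only [← Finset.sum_add_distrib]
    refine Finset.sum_congr rfl fun i _ => Finset.sum_congr rfl fun j _ => ?_
    simp
    ring
  · have h : ∀ i j, (c i * (starRingEnd ℂ) (c j) * (f (g i - g j) : ℂ)).im =
        (c i).im * (c j).re * f (g i - g j) - (c j).im * (c i).re * f (g j - g i) := by
      intro i j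
      rw [← neg_sub (g i) (g j), hf.1]
      simp
      ring
    simp only [h, Finset.sum_sub_distrib]
    rw [Finset.sum_comm]
    simp

end

/-! ### Gram representations and pointwise inequalities -/

theorem isRealPosDef_of_inner {G : Type*} [AddGroup G] {H : Type*} [NormedAddCommGroup H]
    [InnerProductSpace ℝ H] {f : G → ℝ} (e : G → H) (he : ∀ x y, ⟪e x, e y⟫_ℝ = f (x - y)) :
    IsRealPosDef f := by
  refine ⟨fun x => ?_, fun n c g => ?_⟩
  · rw [← sub_zero x, neg_sub, ← he, ← he, real_inner_comm]
  · have h : ∑ i, ∑ j, c i * c j * f (g i - g j) =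
        ⟪∑ i, c i • e (g i), ∑ j, c j • e (g j)⟫_ℝ := by
      rw [sum_inner]
      refine Finset.sum_congr rfl fun i _ => ?_
      rw [inner_sum]
      refine Finset.sum_congr rfl fun j _ => ?_
      rw [real_inner_smul_left, real_inner_smul_right, he]
      ring
    rw [h]
    exact real_inner_self_nonneg

/-- A real positive definite function is a Gram kernel of vectors in a Hilbert space. -/
theorem IsRealPosDef.exists_inner_eq.{u} {G : Type u} [AddGroup G] {f : G → ℝ}
    (hf : IsRealPosDef f) :
    ∃ (H : Type u) (_ : NormedAddCommGroup H) (_ : InnerProductSpace ℝ H) (_ : CompleteSpace H)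
      (e : G → H), ∀ x y, ⟪e x, e y⟫_ℝ = f (x - y) := by
  let K : Matrix G G (ℝ →L[ℝ] ℝ) := .of fun x y => f (x - y) • ContinuousLinearMap.id ℝ ℝ
  have hK : K.PosSemidef := by
    have htfae : K.PosSemidef ↔ K.IsHermitian ∧ ∀ v : G →₀ ℝ, 0 ≤ RCLike.re
        (v.sum fun x w => v.sum fun x' w' => ⟪K x' x w, w'⟫_ℝ) := RKHS.posSemidef_tfae.out 0 2
    refine htfae.mpr ⟨?_, fun v => ?_⟩
    · ext x y
      have hxy : f (y - x) = f (x - y) := by rw [← neg_sub x y, hf.1]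
      simp [K, Matrix.conjTranspose_apply, hxy, ContinuousLinearMap.star_eq_adjoint,
        ContinuousLinearMap.adjoint_id]
    · have h := hf.2 v.support.card (fun i => v (v.support.equivFin.symm i))
        (fun i => (v.support.equivFin.symm i : G))
      simp only [Finsupp.sum]
      refine h.trans_eq ?_
      rw [Equiv.sum_comp v.support.equivFin.symm
        (fun a : v.support => ∑ j, v a * v (v.support.equivFin.symm j) *
          f (a - (v.support.equivFin.symm j : G)))]
      rw [← Finset.sum_coe_sort v.support]
      simp only [RCLike.re_to_real]
      refine Finset.sum_congr rfl fun a _ => ?_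
      rw [Equiv.sum_comp v.support.equivFin.symm
        (fun b : v.support => v a * v b * f ((a : G) - b)), ← Finset.sum_coe_sort v.support]
      refine Finset.sum_congr rfl fun b _ => ?_
      rw [← neg_sub (b : G) a, hf.1]
      simp [K]
      ring
  have : Fact K.PosSemidef := ⟨hK⟩
  refine ⟨RKHS.OfKernel K, inferInstance, inferInstance, inferInstance,
    fun x => RKHS.kerFun (RKHS.OfKernel K) x 1, fun x y => ?_⟩
  rw [← RKHS.kernel_inner, RKHS.OfKernel.kernel_ofKernel, ← neg_sub y x, hf.1]
  simp [K]

section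

variable {G : Type*} [AddGroup G] {f : G → ℝ}

/-- Cauchy–Schwarz for `⟪e x - e y, e 0⟫`. It turns continuity at `0` into uniform continuity with
an explicit modulus. -/
theorem IsRealPosDef.sq_sub_le (hf : IsRealPosDef f) (x y : G) :
    (f x - f y) ^ 2 ≤ 2 * f 0 * (f 0 - f (x - y)) := by
  obtain ⟨H, _, _, _, e, he⟩ := hf.exists_inner_eq
  have h1 : f x - f y = ⟪e x - e y, e 0⟫_ℝ := by simp [inner_sub_left, he]
  have h2 : ‖e 0‖ ^ 2 = f 0 := by rw [← real_inner_self_eq_norm_sq, he, sub_self]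
  have h3 : ‖e x - e y‖ ^ 2 = 2 * (f 0 - f (x - y)) := by
    rw [← real_inner_self_eq_norm_sq, inner_sub_left, inner_sub_right, inner_sub_right]
    rw [he, he, he, he, ← neg_sub x y, hf.1]
    simp
    ring
  calc (f x - f y) ^ 2 = |⟪e x - e y, e 0⟫_ℝ| ^ 2 := by rw [sq_abs, h1]
    _ ≤ (‖e x - e y‖ * ‖e 0‖) ^ 2 := by
      gcongr
      exact abs_real_inner_le_norm _ _
    _ = _ := by rw [mul_pow, h2, h3]; ring

theorem IsRealPosDef.abs_le_apply_zero (hf : IsRealPosDef f) (x : G) : |f x| ≤ f 0 := by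
  obtain ⟨H, _, _, _, e, he⟩ := hf.exists_inner_eq
  have h2 : ∀ y, ‖e y‖ ^ 2 = f 0 := fun y => by rw [← real_inner_self_eq_norm_sq, he, sub_self]
  have h3 : ‖e x‖ = ‖e 0‖ := by
    rw [← sq_eq_sq₀ (norm_nonneg _) (norm_nonneg _), h2, h2]
  calc |f x| = |⟪e x, e 0⟫_ℝ| := by rw [he, sub_zero]
    _ ≤ ‖e x‖ * ‖e 0‖ := abs_real_inner_le_norm _ _
    _ = f 0 := by rw [h3, ← sq, h2]

theorem IsRealPosDef.zero_nonneg (hf : IsRealPosDef f) : 0 ≤ f 0 :=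
  (abs_nonneg _).trans (hf.abs_le_apply_zero 0)

theorem IsRealPosDef.const_mul (hf : IsRealPosDef f) {a : ℝ} (ha : 0 ≤ a) :
    IsRealPosDef (fun x => a * f x) := by
  refine ⟨fun x => by simp only [hf.1], fun n c g => ?_⟩
  refine (mul_nonneg ha (hf.2 n c g)).trans_eq ?_
  simp only [Finset.mul_sum]
  exact Finset.sum_congr rfl fun i _ => Finset.sum_congr rfl fun j _ => by ring

theorem isRealPosDef_of_tendsto {ι : Type*} {l : Filter ι} [l.NeBot] {g : ι → G → ℝ}
    (hg : ∀ i, IsRealPosDef (g i)) (hlim : ∀ x, Filter.Tendsto (fun i => g i x) l (𝓝 (f x))) :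
    IsRealPosDef f := by
  refine ⟨fun x => ?_, fun n c p => ?_⟩
  · refine tendsto_nhds_unique (hlim (-x)) ?_
    simpa only [(hg _).1] using hlim x
  · refine ge_of_tendsto' (tendsto_finsetSum _ fun i _ => tendsto_finsetSum _ fun j _ =>
      (hlim (p i - p j)).const_mul (c i * c j)) fun k => (hg k).2 n c p

end

/-! ### Mollifiers, smoothing and autocorrelations -/

/-- A continuous compactly supported probability density. -/
structure IsMollifier {G : Type*} [TopologicalSpace G] [MeasurableSpace G] (μ : Measure G)
    (φ : G → ℝ) : Prop where
  continuous : Continuous φ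
  hasCompactSupport : HasCompactSupport φ
  nonneg : ∀ x, 0 ≤ φ x
  integral_eq_one : ∫ x, φ x ∂μ = 1

/-- The average of the translates `x ↦ f (x - z)` of `f` with weights `ρ z`. -/
noncomputable def smoothing {G : Type*} [AddGroup G] [MeasurableSpace G] (μ : Measure G)
    (ρ f : G → ℝ) (x : G) : ℝ :=
  ∫ z, ρ z * f (x - z) ∂μ

/-- The autocorrelation `z ↦ ∫ φ s * φ (s + z)` of `φ`. -/
noncomputable def autocorrelation {G : Type*} [AddGroup G] [MeasurableSpace G] (μ : Measure G)
    (φ : G → ℝ) (z : G) : ℝ :=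
  ∫ s, φ s * φ (s + z) ∂μ

/-- The `L¹` distance between `h` and its translate by `z`. -/
noncomputable def translationDistance {G : Type*} [AddGroup G] [MeasurableSpace G]
    (μ : Measure G) (h : G → ℝ) (z : G) : ℝ :=
  ∫ u, |h (u + z) - h u| ∂μ

section

variable {G : Type*} [AddCommGroup G] [TopologicalSpace G] [IsTopologicalAddGroup G]
  [LocallyCompactSpace G] [T2Space G] [MeasurableSpace G] [BorelSpace G]
  {μ : Measure G} [μ.IsAddHaarMeasure] [μ.Regular] {ρ σ φ f h : G → ℝ}

theorem isCompact_sub {K L : Set G} (hK : IsCompact K) (hL : IsCompact L) :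
    IsCompact (K - L) := by
  rw [sub_eq_add_neg]
  exact hK.add hL.neg

theorem integral_sub_mul_eq_smoothing (ρ f : G → ℝ) (x : G) :
    ∫ z, ρ (x - z) * f z ∂μ = smoothing μ ρ f x := by
  rw [smoothing, ← integral_sub_left_eq_self (fun z => ρ z * f (x - z)) μ x]
  simp

theorem continuous_smoothing (hρ : Continuous ρ) (hρc : HasCompactSupport ρ)
    (hf : Continuous f) : Continuous (smoothing μ ρ f) :=
  hρc.continuous_convolution_left (ContinuousLinearMap.lsmul ℝ ℝ) hρ
    (hf.locallyIntegrable (μ := μ))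

theorem hasCompactSupport_smoothing (hρc : HasCompactSupport ρ) (hfc : HasCompactSupport f) :
    HasCompactSupport (smoothing μ ρ f) :=
  hρc.convolution (ContinuousLinearMap.lsmul ℝ ℝ) (μ := μ) hfc

theorem integrable_mul_comp_sub (hρ : Continuous ρ) (hρc : HasCompactSupport ρ)
    (hf : Continuous f) (x : G) : Integrable (fun z => ρ z * f (x - z)) μ :=
  (hρ.mul (hf.comp (continuous_const.sub continuous_id))).integrable_of_hasCompactSupport
    hρc.mul_right

/-- Haar measure need not be σ-finite, so every interchange of integrals goes through continuous
compactly supported integrands. -/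
theorem integral_integral_swap_of_eq_zero {F : G → G → ℝ} (hF : Continuous F.uncurry)
    {K L : Set G} (hK : IsCompact K) (hL : IsCompact L)
    (h0 : ∀ x y, (x ∈ K → y ∉ L) → F x y = 0) :
    ∫ x, (∫ y, F x y ∂μ) ∂μ = ∫ y, (∫ x, F x y ∂μ) ∂μ := by
  refine integral_integral_swap_of_hasCompactSupport hF
    (HasCompactSupport.intro (hK.prod hL) fun p hp => h0 p.1 p.2 fun h1 h2 => hp ⟨h1, h2⟩)

theorem smoothing_comm (hρ : Continuous ρ) (hρc : HasCompactSupport ρ) (hσ : Continuous σ)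
    (hσc : HasCompactSupport σ) (hf : Continuous f) (x : G) :
    smoothing μ ρ (smoothing μ σ f) x = smoothing μ σ (smoothing μ ρ f) x := by
  simp only [smoothing, ← integral_const_mul]
  rw [integral_integral_swap_of_eq_zero (K := tsupport ρ) (L := tsupport σ) _ hρc hσc]
  · refine integral_congr_ae (.of_forall fun z => integral_congr_ae (.of_forall fun t => ?_))
    simp only [sub_right_comm x t z]
    ring
  · intro z t hzt
    by_cases hz : z ∈ tsupport ρ
    · simp [image_eq_zero_of_notMem_tsupport (hzt hz)]
    · simp [image_eq_zero_of_notMem_tsupport hz]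
  · simp only [Function.uncurry_def]
    fun_prop

theorem integral_smoothing_mul (hρ : Continuous ρ) (hρc : HasCompactSupport ρ)
    (hρe : ∀ x, ρ (-x) = ρ x) (hf : Continuous f) (hh : Continuous h)
    (hhc : HasCompactSupport h) :
    ∫ x, smoothing μ ρ f x * h x ∂μ = ∫ x, f x * smoothing μ ρ h x ∂μ := by
  simp only [← integral_sub_mul_eq_smoothing, ← integral_const_mul, ← integral_mul_const]
  rw [integral_integral_swap_of_eq_zero (K := tsupport h) (L := tsupport h - tsupport ρ) _ hhc
    (isCompact_sub hhc hρc)]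
  · refine integral_congr_ae (.of_forall fun z => integral_congr_ae (.of_forall fun t => ?_))
    simp only [← neg_sub z t, hρe]
    ring
  · intro x z hxz
    by_cases hx : x ∈ tsupport h
    · have h1 : x - z ∉ tsupport ρ := fun h1 =>
        hxz hx (Set.mem_sub.mpr ⟨x, hx, x - z, h1, by abel⟩)
      simp [image_eq_zero_of_notMem_tsupport h1]
    · simp [image_eq_zero_of_notMem_tsupport hx]
  · simp only [Function.uncurry_def]
    fun_prop

theorem IsMollifier.abs_smoothing_sub_le (hρ : IsMollifier μ ρ) (hf : Continuous f) {a ε : ℝ}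
    {x : G} (h : ∀ z, ρ z ≠ 0 → |f (x - z) - a| ≤ ε) : |smoothing μ ρ f x - a| ≤ ε := by
  have hint : Integrable ρ μ := hρ.continuous.integrable_of_hasCompactSupport hρ.hasCompactSupport
  have h1 : smoothing μ ρ f x - a = ∫ z, ρ z * (f (x - z) - a) ∂μ := by
    simp only [mul_sub]
    rw [integral_sub (integrable_mul_comp_sub hρ.continuous hρ.hasCompactSupport hf x)
      (hint.mul_const a), integral_mul_const, hρ.integral_eq_one, one_mul, smoothing]
  rw [h1]
  have h2 : ∫ z, ρ z * ε ∂μ = ε := by rw [integral_mul_const, hρ.integral_eq_one, one_mul]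
  rw [← h2, ← Real.norm_eq_abs]
  refine norm_integral_le_of_norm_le (hint.mul_const ε) (.of_forall fun z => ?_)
  rw [norm_mul, Real.norm_eq_abs, Real.norm_eq_abs, abs_of_nonneg (hρ.nonneg z)]
  by_cases hz : ρ z = 0
  · simp [hz]
  · exact mul_le_mul_of_nonneg_left (h z hz) (hρ.nonneg z)

theorem tendsto_translationDistance (hh : Continuous h) (hhc : HasCompactSupport h) :
    Filter.Tendsto (translationDistance μ h) (𝓝 0) (𝓝 0) := by
  -- Restricting `z` to a compact neighbourhood of `0` puts all the integrands inside one compact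
  -- set.
  obtain ⟨V, hV, hV0⟩ := exists_compact_mem_nhds (0 : G)
  have h1 : ContinuousOn (translationDistance μ h) V := by
    refine continuousOn_integral_of_compact_support (f := fun z u => |h (u + z) - h u|)
      (k := tsupport h ∪ (tsupport h - V)) (hhc.isCompact.union (isCompact_sub hhc hV)) ?_ ?_
    · refine Continuous.continuousOn ?_
      simp only [Function.uncurry_def]
      fun_prop
    · intro z u hz hu
      have hu1 : u ∉ tsupport h := fun h1 => hu (Or.inl h1)
      have hu2 : u + z ∉ tsupport h := fun h1 =>
        hu (Or.inr (Set.mem_sub.mpr ⟨u + z, h1, z, hz, by abel⟩))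
      simp [image_eq_zero_of_notMem_tsupport hu1, image_eq_zero_of_notMem_tsupport hu2]
  have h2 := (h1.continuousAt hV0).tendsto
  simpa [translationDistance] using h2

/-- The modulus of continuity depends on the mollifier alone, hence is uniform over all `f` bounded
by `1`. -/
theorem abs_smoothing_sub_smoothing_le (hρ : Continuous ρ) (hρc : HasCompactSupport ρ)
    (hf : Continuous f) (hf1 : ∀ x, |f x| ≤ 1) (x y : G) :
    |smoothing μ ρ f x - smoothing μ ρ f y| ≤ translationDistance μ ρ (x - y) := by
  have hint : ∀ x : G, Integrable (fun z => ρ (x - z) * f z) μ := fun x =>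
    ((hρ.comp (continuous_const.sub continuous_id)).mul hf).integrable_of_hasCompactSupport
      (HasCompactSupport.mul_right (hρc.comp_homeomorph (Homeomorph.subLeft x)))
  have hint' : ∀ x : G, Integrable (fun z => ρ (x - z)) μ := fun x =>
    (hρ.comp (continuous_const.sub continuous_id)).integrable_of_hasCompactSupport
      (hρc.comp_homeomorph (Homeomorph.subLeft x))
  rw [← integral_sub_mul_eq_smoothing, ← integral_sub_mul_eq_smoothing,
    ← integral_sub (hint x) (hint y)]
  have h2 : translationDistance μ ρ (x - y) = ∫ z, |ρ (x - z) - ρ (y - z)| ∂μ := by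
    rw [translationDistance, ← integral_sub_left_eq_self _ μ y]
    refine integral_congr_ae (.of_forall fun z => ?_)
    simp only
    congr 3
    abel
  rw [h2, ← Real.norm_eq_abs]
  refine norm_integral_le_of_norm_le ((hint' x).sub (hint' y)).abs (.of_forall fun z => ?_)
  rw [← sub_mul, norm_mul, Real.norm_eq_abs, Real.norm_eq_abs]
  exact mul_le_of_le_one_right (abs_nonneg _) (hf1 z)

/-- Smoothing with densities of small support moves a compactly supported continuous function
only little in `L¹`. -/
theorem exists_nhds_integral_abs_smoothing_sub_le (hh : Continuous h)
    (hhc : HasCompactSupport h) {ε : ℝ} (hε : 0 < ε) :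
    ∃ V ∈ 𝓝 (0 : G), ∀ ρ, IsMollifier μ ρ → Function.support ρ ⊆ V →
      ∫ x, |smoothing μ ρ h x - h x| ∂μ ≤ ε := by
  have h1 : ∀ᶠ z in 𝓝 (0 : G), translationDistance μ h (-z) < ε := by
    have h2 : Filter.Tendsto (fun z : G => -z) (𝓝 0) (𝓝 0) := by
      simpa using (continuous_neg (G := G)).tendsto 0
    exact ((tendsto_translationDistance hh hhc).comp h2).eventually_lt_const hε
  refine ⟨_, h1, fun ρ hρ hV => ?_⟩
  have hint : Integrable ρ μ := hρ.continuous.integrable_of_hasCompactSupport hρ.hasCompactSupport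
  have hsm : Continuous (smoothing μ ρ h) :=
    continuous_smoothing hρ.continuous hρ.hasCompactSupport hh
  have hsmc : HasCompactSupport (smoothing μ ρ h) :=
    hasCompactSupport_smoothing hρ.hasCompactSupport hhc
  have hF : Continuous (Function.uncurry fun x z : G => ρ z * |h (x - z) - h x|) := by
    have := hρ.continuous
    simp only [Function.uncurry_def]
    fun_prop
  let K : Set G := tsupport h ∪ (tsupport h + tsupport ρ)
  have hK : IsCompact K :=
    hhc.isCompact.union (hhc.isCompact.add hρ.hasCompactSupport)
  have h0 : ∀ x z : G, (x ∈ K → z ∉ tsupport ρ) → ρ z * |h (x - z) - h x| = 0 := by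
    intro x z hxz
    by_cases hz : z ∈ tsupport ρ
    · have hx : x ∉ K := fun hx => hxz hx hz
      have hu1 : x ∉ tsupport h := fun h1 => hx (Or.inl h1)
      have hu2 : x - z ∉ tsupport h := fun h1 =>
        hx (Or.inr (Set.mem_add.mpr ⟨x - z, h1, z, hz, by abel⟩))
      simp [image_eq_zero_of_notMem_tsupport hu1, image_eq_zero_of_notMem_tsupport hu2]
    · simp [image_eq_zero_of_notMem_tsupport hz]
  calc ∫ x, |smoothing μ ρ h x - h x| ∂μ
      ≤ ∫ x, ∫ z, ρ z * |h (x - z) - h x| ∂μ ∂μ := by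
        refine integral_mono ((hsm.sub hh).integrable_of_hasCompactSupport
          (hsmc.sub hhc)).abs ?_ fun x => ?_
        · refine Continuous.integrable_of_hasCompactSupport ?_
            (HasCompactSupport.intro hK fun x hx => ?_)
          · rw [← continuousOn_univ]
            exact continuousOn_integral_of_compact_support (k := tsupport ρ)
              hρ.hasCompactSupport hF.continuousOn fun x z _ hz => h0 x z fun _ => hz
          · simp [h0 x _ fun hx' => absurd hx' hx]
        · have h2 : smoothing μ ρ h x - h x = ∫ z, ρ z * (h (x - z) - h x) ∂μ := by
            simp only [mul_sub]
            rw [integral_sub (integrable_mul_comp_sub hρ.continuous hρ.hasCompactSupport hh x)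
              (hint.mul_const _), integral_mul_const, hρ.integral_eq_one, one_mul, smoothing]
          simp only [h2]
          refine abs_integral_le_integral_abs.trans_eq ?_
          simp only [abs_mul, abs_of_nonneg (hρ.nonneg _)]
    _ = ∫ z, ρ z * translationDistance μ h (-z) ∂μ := by
        rw [integral_integral_swap_of_eq_zero hF hK hρ.hasCompactSupport h0]
        simp only [integral_const_mul, translationDistance, sub_eq_add_neg]
    _ ≤ ∫ z, ρ z * ε ∂μ := by
        refine integral_mono_of_nonneg (.of_forall fun z => ?_) (hint.mul_const ε)
          (.of_forall fun z => ?_)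
        · exact mul_nonneg (hρ.nonneg z) (integral_nonneg fun u => abs_nonneg _)
        · by_cases hz : ρ z = 0
          · simp [hz]
          · exact mul_le_mul_of_nonneg_left (hV hz).le (hρ.nonneg z)
    _ = ε := by rw [integral_mul_const, hρ.integral_eq_one, one_mul]

theorem IsMollifier.comp_neg (hφ : IsMollifier μ φ) : IsMollifier μ (fun x => φ (-x)) where
  continuous := hφ.continuous.comp continuous_neg
  hasCompactSupport := hφ.hasCompactSupport.comp_homeomorph (Homeomorph.neg G)
  nonneg x := hφ.nonneg _
  integral_eq_one := by rw [integral_neg_eq_self, hφ.integral_eq_one]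

theorem IsMollifier.smoothing (hρ : IsMollifier μ ρ) (hφ : IsMollifier μ φ) :
    IsMollifier μ (smoothing μ ρ φ) where
  continuous := continuous_smoothing hρ.continuous hρ.hasCompactSupport hφ.continuous
  hasCompactSupport := hasCompactSupport_smoothing hρ.hasCompactSupport hφ.hasCompactSupport
  nonneg x := integral_nonneg fun z => mul_nonneg (hρ.nonneg z) (hφ.nonneg _)
  integral_eq_one := by
    simp only [_root_.smoothing]
    rw [integral_integral_swap_of_eq_zero (K := tsupport φ + tsupport ρ) (L := tsupport ρ) _
      (hφ.hasCompactSupport.isCompact.add hρ.hasCompactSupport) hρ.hasCompactSupport]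
    · simp only [integral_const_mul, integral_sub_right_eq_self (μ := μ) φ, hφ.integral_eq_one,
        mul_one, hρ.integral_eq_one]
    · intro x z hxz
      by_cases hz : z ∈ tsupport ρ
      · have hu : x - z ∉ tsupport φ := fun h1 =>
          hxz (Set.mem_add.mpr ⟨x - z, h1, z, hz, by abel⟩) hz
        simp [image_eq_zero_of_notMem_tsupport hu]
      · simp [image_eq_zero_of_notMem_tsupport hz]
    · have := hρ.continuous
      have := hφ.continuous
      simp only [Function.uncurry_def]
      fun_prop

theorem autocorrelation_eq_smoothing (φ : G → ℝ) :
    autocorrelation μ φ = smoothing μ (fun x => φ (-x)) φ := by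
  ext z
  rw [autocorrelation, smoothing, ← integral_neg_eq_self]
  refine integral_congr_ae (.of_forall fun s => ?_)
  simp only
  congr 2
  abel

theorem IsMollifier.autocorrelation (hφ : IsMollifier μ φ) :
    IsMollifier μ (autocorrelation μ φ) := by
  rw [autocorrelation_eq_smoothing]
  exact hφ.comp_neg.smoothing hφ

/-- The kernel `autocorrelation μ φ (x - y)` is the `L²` inner product of translates of `φ`, so its
quadratic form is the integral of a square. -/
theorem isRealPosDef_autocorrelation (hφ : IsMollifier μ φ) :
    IsRealPosDef (autocorrelation μ φ) := by
  have hc := hφ.continuous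
  have key : ∀ x y : G, autocorrelation μ φ (x - y) = ∫ s, φ (s + x) * φ (s + y) ∂μ := by
    intro x y
    rw [autocorrelation, ← integral_add_right_eq_self _ y]
    refine integral_congr_ae (.of_forall fun s => ?_)
    simp only
    rw [mul_comm]
    congr 2
    abel
  have hint : ∀ x y : G, Integrable (fun s => φ (s + x) * φ (s + y)) μ := fun x y =>
    Continuous.integrable_of_hasCompactSupport (by fun_prop)
      (HasCompactSupport.mul_right
        (hφ.hasCompactSupport.comp_homeomorph (Homeomorph.addRight x)))
  refine ⟨fun x => ?_, fun n c g => ?_⟩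
  · rw [← sub_zero x, neg_sub, key, key]
    simp only [mul_comm]
  · have h1 : ∑ i, ∑ j, c i * c j * _root_.autocorrelation μ φ (g i - g j) =
        ∫ s, (∑ i, c i * φ (s + g i)) ^ 2 ∂μ := by
      simp only [key, ← integral_const_mul]
      have h2 : ∀ i j, Integrable (fun s => c i * c j * (φ (s + g i) * φ (s + g j))) μ :=
        fun i j => (hint _ _).const_mul _
      simp only [← integral_finsetSum _ fun j _ => h2 _ j]
      rw [← integral_finsetSum _ fun i _ => integrable_finsetSum _ fun j _ => h2 i j]
      refine integral_congr_ae (.of_forall fun s => ?_)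
      simp only [sq, Finset.sum_mul_sum]
      exact Finset.sum_congr rfl fun i _ => Finset.sum_congr rfl fun j _ => by ring
    rw [h1]
    exact integral_nonneg fun s => sq_nonneg _

theorem autocorrelation_zero_pos (hφ : IsMollifier μ φ) : 0 < autocorrelation μ φ 0 := by
  have hc := hφ.continuous
  obtain ⟨x, hx⟩ : ∃ x, φ x ≠ 0 := by
    by_contra! h
    simpa [h] using hφ.integral_eq_one
  refine Continuous.integral_pos_of_hasCompactSupport_nonneg_nonzero (x := x) (by fun_prop)
    (HasCompactSupport.mul_right hφ.hasCompactSupport) (fun s => ?_) ?_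
  · simpa using mul_self_nonneg (φ s)
  · simpa using hx

theorem support_autocorrelation_subset (φ : G → ℝ) :
    Function.support (autocorrelation μ φ) ⊆ Function.support φ - Function.support φ := by
  intro z hz
  by_contra hz'
  refine hz ?_
  have : ∀ s, φ s * φ (s + z) = 0 := by
    intro s
    by_contra hs
    exact hz' (Set.mem_sub.mpr ⟨s + z, right_ne_zero_of_mul hs, s, left_ne_zero_of_mul hs, by abel⟩)
  simp [_root_.autocorrelation, this]

theorem exists_isMollifier_support_autocorrelation_subset (μ : Measure G)
    [μ.IsAddHaarMeasure] [μ.Regular] {V : Set G} (hV : V ∈ 𝓝 (0 : G)) :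
    ∃ φ, IsMollifier μ φ ∧ Function.support (autocorrelation μ φ) ⊆ V := by
  have h1 : Filter.Tendsto (fun p : G × G => p.1 - p.2) (𝓝 (0, 0)) (𝓝 0) := by
    have h2 : Continuous fun p : G × G => p.1 - p.2 := by fun_prop
    simpa using h2.tendsto (0, 0)
  rw [nhds_prod_eq] at h1
  obtain ⟨U, hU, hUV⟩ := Filter.mem_prod_self_iff.mp (h1 hV)
  obtain ⟨g, hg1, hg0, hgc, hg⟩ := exists_continuous_one_zero_of_isCompact
    (isCompact_singleton (x := (0 : G))) isOpen_interior.isClosed_compl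
    (Set.disjoint_singleton_left.mpr fun h => h (mem_interior_iff_mem_nhds.mpr hU))
  have hg00 : g 0 = 1 := hg1 rfl
  have hpos : 0 < ∫ x, g x ∂μ :=
    g.continuous.integral_pos_of_hasCompactSupport_nonneg_nonzero hgc (fun x => (hg x).1)
      (x := 0) (by simp [hg00])
  have hsupp : Function.support (fun x => (∫ y, g y ∂μ)⁻¹ * g x) ⊆ U := by
    intro x hx
    by_contra hxU
    have : g x = 0 := hg0 fun h => hxU (interior_subset h)
    simp [this] at hx
  refine ⟨fun x => (∫ y, g y ∂μ)⁻¹ * g x, ⟨by fun_prop, hgc.mul_left, fun x =>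
    mul_nonneg (inv_nonneg.mpr hpos.le) (hg x).1, ?_⟩, ?_⟩
  · rw [integral_const_mul, inv_mul_cancel₀ hpos.ne']
  · refine (support_autocorrelation_subset _).trans ?_
    rintro _ ⟨a, ha, b, hb, rfl⟩
    exact hUV (Set.mk_mem_prod (hsupp ha) (hsupp hb))

/-- The double average over `s` and `t` is the form in which the smoothing appears as an inner
product of averaged Gram vectors. -/
theorem smoothing_autocorrelation (hφ : IsMollifier μ φ) (hf : Continuous f) (x : G) :
    smoothing μ (autocorrelation μ φ) f x =
      ∫ s, φ s * ∫ t, φ t * f (x + s - t) ∂μ ∂μ := by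
  have hc := hφ.continuous
  simp only [smoothing, autocorrelation, ← integral_mul_const]
  rw [integral_integral_swap_of_eq_zero (K := tsupport φ - tsupport φ) (L := tsupport φ) _
      (isCompact_sub hφ.hasCompactSupport hφ.hasCompactSupport) hφ.hasCompactSupport]
  · refine integral_congr_ae (.of_forall fun s => ?_)
    simp only [mul_assoc, integral_const_mul]
    rw [← integral_add_left_eq_self (fun t => φ t * f (x + s - t)) s]
    simp only [add_comm x s, add_sub_add_left_eq_sub]
  · intro z s hzs
    by_cases hs : s ∈ tsupport φ
    · have hu : s + z ∉ tsupport φ := fun h1 =>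
        hzs (Set.mem_sub.mpr ⟨s + z, h1, s, hs, by abel⟩) hs
      simp [image_eq_zero_of_notMem_tsupport hu]
    · simp [image_eq_zero_of_notMem_tsupport hs]
  · simp only [Function.uncurry_def]
    fun_prop

/-- Smoothing a positive definite function with an autocorrelation keeps it positive definite,
and controls its oscillation at `0` from below. -/
theorem IsRealPosDef.smoothing_autocorrelation (hf : IsRealPosDef f) (hfc : Continuous f)
    (hφ : IsMollifier μ φ) :
    IsRealPosDef (smoothing μ (autocorrelation μ φ) f) ∧
      ∀ x, f 0 - f x ≤ 2 * (f 0 - smoothing μ (autocorrelation μ φ) f x) := by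
  obtain ⟨H, _, _, _, e, he⟩ := hf.exists_inner_eq
  have hφc := hφ.continuous
  have hec : Continuous e := by
    refine continuous_iff_continuousAt.mpr fun y => ?_
    rw [ContinuousAt, tendsto_iff_norm_sub_tendsto_zero]
    have h1 : ∀ x, ‖e x - e y‖ = √(2 * (f 0 - f (x - y))) := by
      intro x
      rw [eq_comm, Real.sqrt_eq_iff_eq_sq (by linarith [abs_le.mp (hf.abs_le_apply_zero (x - y))])
        (norm_nonneg _), ← real_inner_self_eq_norm_sq, inner_sub_left, inner_sub_right,
        inner_sub_right, he, he, he, he, ← neg_sub x y, hf.1]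
      simp
      ring
    simp only [h1]
    have h2 : Continuous fun x => √(2 * (f 0 - f (x - y))) := by fun_prop
    simpa using h2.tendsto y
  -- Averaged Gram vectors; by `hww` their Gram kernel is the smoothed function.
  let w : G → H := fun x => ∫ s, φ s • e (x + s) ∂μ
  have hint : ∀ x, Integrable (fun s => φ s • e (x + s)) μ := fun x =>
    Continuous.integrable_of_hasCompactSupport (by fun_prop)
      (HasCompactSupport.smul_right hφ.hasCompactSupport)
  have hw : ∀ (x : G) (v : H), ⟪w x, v⟫_ℝ = ∫ s, φ s * ⟪e (x + s), v⟫_ℝ ∂μ := by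
    intro x v
    rw [real_inner_comm, ← integral_inner (hint x)]
    simp only [real_inner_smul_right, real_inner_comm v]
  have hww : ∀ x y, ⟪w x, w y⟫_ℝ = smoothing μ (autocorrelation μ φ) f (x - y) := by
    intro x y
    rw [hw, _root_.smoothing_autocorrelation hφ hfc]
    refine integral_congr_ae (.of_forall fun s => ?_)
    simp only
    rw [real_inner_comm, hw]
    congr 1
    refine integral_congr_ae (.of_forall fun t => ?_)
    simp only [he]
    rw [← neg_sub, hf.1]
    congr 2
    abel
  refine ⟨isRealPosDef_of_inner w hww, fun x => ?_⟩
  have hφint : Integrable φ μ := hφc.integrable_of_hasCompactSupport hφ.hasCompactSupport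
  have hint2 : ∀ x, Integrable (fun s => φ s * ⟪e (x + s), w 0⟫_ℝ) μ := fun x =>
    Continuous.integrable_of_hasCompactSupport (by fun_prop)
      (HasCompactSupport.mul_right hφ.hasCompactSupport)
  -- When this square is expanded the terms in `⟪w 0, w 0⟫` cancel, leaving `f 0 + f x ≥ 2 *
  -- smoothing μ (autocorrelation μ φ) f x`, which is the claim rearranged.
  have h1 : 0 ≤ ∫ s, φ s * ‖e (x + s) + e (0 + s) - (2 : ℝ) • w 0‖ ^ 2 ∂μ :=
    integral_nonneg fun s => mul_nonneg (hφ.nonneg s) (sq_nonneg _)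
  have h2 : ∀ s, φ s * ‖e (x + s) + e (0 + s) - (2 : ℝ) • w 0‖ ^ 2 =
      φ s * (2 * f 0 + 2 * f x + 4 * ⟪w 0, w 0⟫_ℝ) -
        4 * (φ s * ⟪e (x + s), w 0⟫_ℝ + φ s * ⟪e (0 + s), w 0⟫_ℝ) := by
    intro s
    have hx : ⟪e (x + s), e (0 + s)⟫_ℝ = f x := by rw [he]; simp
    have h0 : ∀ y, ⟪e y, e y⟫_ℝ = f 0 := fun y => by rw [he, sub_self]
    rw [← real_inner_self_eq_norm_sq]
    simp only [inner_sub_left, inner_sub_right, inner_add_left, inner_add_right,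
      real_inner_smul_left, real_inner_smul_right, h0, hx, real_inner_comm (e (x + s)) (e (0 + s)),
      real_inner_comm (e (x + s)) (w 0), real_inner_comm (e (0 + s)) (w 0)]
    ring
  simp only [h2] at h1
  have h3 : Integrable (fun s => 4 * (φ s * ⟪e (x + s), w 0⟫_ℝ + φ s * ⟪e (0 + s), w 0⟫_ℝ)) μ :=
    ((hint2 x).add (hint2 0)).const_mul 4
  rw [integral_sub (hφint.mul_const _) h3,
    integral_mul_const, hφ.integral_eq_one, integral_const_mul,
    integral_add (hint2 x) (hint2 0), ← hw, ← hw, hww x 0, sub_zero] at h1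
  linarith

end

/-! ### Limits along ultrafilters -/

theorem Ultrafilter.exists_tendsto_of_abs_le {ι : Type*} (W : Ultrafilter ι) {u : ι → ℝ} {C : ℝ}
    (hu : ∀ i, |u i| ≤ C) : ∃ L, Filter.Tendsto u W (𝓝 L) := by
  obtain ⟨L, -, hL⟩ := (isCompact_Icc (a := -C) (b := C)).ultrafilter_le_nhds (W.map u) (by
    rw [Filter.le_principal_iff]
    exact Filter.mem_map.mpr (Filter.Eventually.of_forall fun i => abs_le.mp (hu i)))
  exact ⟨L, hL⟩

/-- A family of positive definite functions that is equicontinuous at `0` along an ultrafilter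
converges along it, uniformly on compact sets, to a continuous positive definite function. -/
theorem exists_isRealPosDef_limit {G : Type*} [AddCommGroup G] [TopologicalSpace G]
    [IsTopologicalAddGroup G] {κ : Type*} (W : Ultrafilter κ) {g : κ → G → ℝ}
    (hg : ∀ k, IsRealPosDef (g k)) (hg0 : ∀ k, g k 0 ≤ 1)
    (heq : ∀ ε > 0, ∃ V ∈ 𝓝 (0 : G), ∀ᶠ k in W, ∀ z ∈ V, g k 0 - g k z ≤ ε) :
    ∃ F : G → ℝ, Continuous F ∧ IsRealPosDef F ∧ F 0 ≤ 1 ∧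
      ∀ K, IsCompact K → ∀ ε > 0, ∀ᶠ k in W, ∀ x ∈ K, |g k x - F x| ≤ ε := by
  choose F hF using fun x => W.exists_tendsto_of_abs_le (u := fun k => g k x) (C := 1)
    fun k => ((hg k).abs_le_apply_zero x).trans (hg0 k)
  have h1 : ∀ ε > 0, ∃ V ∈ 𝓝 (0 : G), ∀ᶠ k in W, ∀ x y, x - y ∈ V → |g k x - g k y| ≤ ε := by
    intro ε hε
    -- By `sq_sub_le` an oscillation of `ε ^ 2 / 2` at `0` gives one of `ε` between any two points
    -- differing by an element of `V`.
    obtain ⟨V, hV, h⟩ := heq (ε ^ 2 / 2) (by positivity)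
    refine ⟨V, hV, h.mono fun k hk x y hxy => abs_le_of_sq_le_sq ?_ hε.le⟩
    have h2 := (hg k).sq_sub_le x y
    have h3 := hk _ hxy
    have h4 := (abs_le.mp ((hg k).abs_le_apply_zero (x - y))).2
    nlinarith [mul_nonneg (sub_nonneg.mpr (hg0 k)) (sub_nonneg.mpr h4)]
  have h2 : ∀ ε > 0, ∃ V ∈ 𝓝 (0 : G), (∀ x y, x - y ∈ V → |F x - F y| ≤ ε) ∧
      ∀ᶠ k in W, ∀ x y, x - y ∈ V → |g k x - g k y| ≤ ε := by
    intro ε hε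
    obtain ⟨V, hV, h⟩ := h1 ε hε
    exact ⟨V, hV, fun x y hxy => le_of_tendsto ((hF x).sub (hF y)).abs
      (h.mono fun k hk => hk x y hxy), h⟩
  have hnhds : ∀ V ∈ 𝓝 (0 : G), ∀ x, {y | y - x ∈ V} ∈ 𝓝 x := by
    intro V hV x
    have h3 : Continuous fun y : G => y - x := by fun_prop
    have h4 := h3.tendsto x
    rw [sub_self] at h4
    exact h4 hV
  refine ⟨F, ?_, isRealPosDef_of_tendsto hg hF, le_of_tendsto' (hF 0) hg0, ?_⟩
  · refine continuous_iff_continuousAt.mpr fun x => Metric.tendsto_nhds.mpr fun ε hε => ?_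
    obtain ⟨V, hV, h, -⟩ := h2 (ε / 2) (by positivity)
    filter_upwards [hnhds V hV x] with y hy
    rw [Real.dist_eq]
    linarith [h y x hy]
  · intro K hK ε hε
    obtain ⟨V, hV, hFV, hgV⟩ := h2 (ε / 3) (by positivity)
    obtain ⟨t, -, ht⟩ := hK.elim_nhds_subcover _ fun x _ => hnhds V hV x
    have h5 : ∀ᶠ k in W, ∀ x ∈ t, |g k x - F x| < ε / 3 := by
      rw [Filter.eventually_all_finset]
      intro x _
      have := Metric.tendsto_nhds.mp (hF x) (ε / 3) (by positivity)
      simpa only [Real.dist_eq] using this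
    filter_upwards [h5, hgV] with k hk1 hk2 x hx
    obtain ⟨y, hy, hxy⟩ := Set.mem_iUnion₂.mp (ht hx)
    have e1 := abs_le.mp (hk2 x y hxy)
    have e2 := abs_le.mp (hFV x y hxy)
    have e3 := abs_lt.mp (hk1 y hy)
    exact abs_le.mpr ⟨by linarith, by linarith⟩

section

variable {G : Type*} [AddCommGroup G] [TopologicalSpace G] [IsTopologicalAddGroup G]
  [LocallyCompactSpace G] [T2Space G] [MeasurableSpace G] [BorelSpace G]
  {μ : Measure G} [μ.IsAddHaarMeasure] [μ.Regular]

/-- Quantitative equicontinuity at `0` of smoothings: if smoothing `f` with `autocorrelation μ φ`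
loses little at `0`, then smoothings of `f` on a finer scale oscillate little near `0`. -/
theorem smoothing_zero_sub_le {f φ ψ : G → ℝ} (hf : IsRealPosDef f) (hfc : Continuous f)
    (hf0 : f 0 = 1) (hφ : IsMollifier μ φ) (hψ : IsMollifier μ ψ) {M ε : ℝ} {z : G}
    (hψM : smoothing μ (autocorrelation μ ψ) f 0 ≤ M + ε)
    (hφM : M - ε ≤ smoothing μ (autocorrelation μ φ) f 0)
    (hz : ∀ t, autocorrelation μ ψ t ≠ 0 →
      translationDistance μ (autocorrelation μ φ) (z - t) ≤ ε) :
    smoothing μ (autocorrelation μ ψ) f 0 - smoothing μ (autocorrelation μ ψ) f z ≤ 6 * ε := by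
  have hρ := hφ.autocorrelation
  have hσ := hψ.autocorrelation
  have h1 := ((hf.smoothing_autocorrelation hfc hψ).1.smoothing_autocorrelation
    (continuous_smoothing hσ.continuous hσ.hasCompactSupport hfc) hφ).2 z
  rw [smoothing_comm hρ.continuous hρ.hasCompactSupport hσ.continuous hσ.hasCompactSupport hfc]
    at h1
  have h2 := hσ.abs_smoothing_sub_le (x := z) (ε := ε)
    (a := smoothing μ (autocorrelation μ φ) f 0)
    (continuous_smoothing hρ.continuous hρ.hasCompactSupport hfc) fun t ht => by
      refine (abs_smoothing_sub_smoothing_le hρ.continuous hρ.hasCompactSupport hfc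
        (fun x => (hf.abs_le_apply_zero x).trans_eq hf0) (z - t) 0).trans ?_
      rw [sub_zero]
      exact hz t ht
  -- The twice smoothed value at `z` is at least `M - 2 * ε` and the value at `0` is at most `M +
  -- ε`; the gap `3 * ε` is doubled by `h1`.
  linarith [abs_le.mp h2]

/-- Weak compactness: along an ultrafilter, normalised continuous positive definite functions
converge, when tested against compactly supported continuous functions, to a continuous positive
definite function. -/
theorem exists_isRealPosDef_weak_limit (μ : Measure G) [μ.IsAddHaarMeasure] [μ.Regular]
    {ι : Type*} (U : Ultrafilter ι) {f : ι → G → ℝ}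
    (hf : ∀ n, IsRealPosDef (f n)) (hfc : ∀ n, Continuous (f n)) (hf0 : ∀ n, f n 0 = 1) :
    ∃ F : G → ℝ, Continuous F ∧ IsRealPosDef F ∧ F 0 ≤ 1 ∧
      ∀ h : G → ℝ, Continuous h → HasCompactSupport h →
        Filter.Tendsto (fun n => ∫ x, f n x * h x ∂μ) U (𝓝 (∫ x, F x * h x ∂μ)) := by
  have hf1 : ∀ n x, |f n x| ≤ 1 := fun n x => ((hf n).abs_le_apply_zero x).trans_eq (hf0 n)
  let s : {φ : G → ℝ // IsMollifier μ φ} → ι → G → ℝ :=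
    fun φ n => smoothing μ (autocorrelation μ φ) (f n)
  have hsp : ∀ φ n, IsRealPosDef (s φ n) := fun φ n =>
    ((hf n).smoothing_autocorrelation (hfc n) φ.2).1
  have hsc : ∀ φ n, Continuous (s φ n) := fun φ n =>
    continuous_smoothing φ.2.autocorrelation.continuous φ.2.autocorrelation.hasCompactSupport
      (hfc n)
  have hs1 : ∀ φ n x, |s φ n x| ≤ 1 := fun φ n x => by
    have := φ.2.autocorrelation.abs_smoothing_sub_le (hfc n) (x := x) (a := 0) (ε := 1)
      fun z _ => by simpa using hf1 n (x - z)
    simpa using this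
  choose m hm using fun φ => U.exists_tendsto_of_abs_le fun n => hs1 φ n 0
  have hm1 : ∀ φ, m φ ≤ 1 := fun φ =>
    le_of_tendsto' (hm φ) fun n => (le_abs_self _).trans (hs1 φ n 0)
  have hbdd : BddAbove (Set.range m) := ⟨1, by rintro _ ⟨φ, rfl⟩; exact hm1 φ⟩
  obtain ⟨φ₀, hφ₀, -⟩ := exists_isMollifier_support_autocorrelation_subset μ
    (V := Set.univ) Filter.univ_mem
  have : Nonempty {φ : G → ℝ // IsMollifier μ φ} := ⟨⟨φ₀, hφ₀⟩⟩
  -- No mollifier beats `M` in the limit, while some come arbitrarily close: this is what makes fine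
  -- smoothings equicontinuous.
  let M := ⨆ φ, m φ
  let 𝒱 : Filter {φ : G → ℝ // IsMollifier μ φ} :=
    (𝓝 (0 : G)).smallSets.comap fun φ => Function.support (autocorrelation μ φ.1)
  have h𝒱 : ∀ V ∈ 𝓝 (0 : G), ∀ᶠ φ in 𝒱, Function.support (autocorrelation μ φ.1) ⊆ V :=
    fun V hV => Filter.tendsto_comap.eventually (Filter.eventually_smallSets_subset.mpr hV)
  have h𝒱ne : 𝒱.NeBot := by
    refine Filter.comap_neBot fun t ht => ?_
    obtain ⟨V, hV, h⟩ := Filter.eventually_smallSets.mp ht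
    obtain ⟨φ, hφ, hφV⟩ := exists_isMollifier_support_autocorrelation_subset μ hV
    exact ⟨⟨φ, hφ⟩, h _ hφV⟩
  -- An iterated limit: `n` runs along `U` for a fixed mollifier, then the supports shrink to `0`.
  -- The order matters, as the relevant set of `n` depends on the mollifier.
  let W₀ : Filter ({φ : G → ℝ // IsMollifier μ φ} × ι) :=
    𝒱.bind fun φ => Filter.map (Prod.mk φ) U
  have hW₀ne : W₀.NeBot := by
    refine ⟨fun h => ?_⟩
    have h1 : ∀ᶠ w in W₀, False := by simp [h]
    have h2 : ∀ᶠ φ in 𝒱, ∀ᶠ n in (U : Filter ι), False := Filter.eventually_bind.mp h1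
    obtain ⟨φ, hφ⟩ := h2.exists
    obtain ⟨n, hn⟩ := hφ.exists
    exact hn
  let W := Ultrafilter.of W₀
  have hW : ∀ {p : {φ : G → ℝ // IsMollifier μ φ} × ι → Prop},
      (∀ᶠ φ in 𝒱, ∀ᶠ n in (U : Filter ι), p (φ, n)) → ∀ᶠ w in W, p w := fun {p} hp =>
    Ultrafilter.of_le W₀ (Filter.eventually_bind.mpr hp)
  let t : {φ : G → ℝ // IsMollifier μ φ} × ι → G → ℝ := fun w => s w.1 w.2
  have heq : ∀ ε > 0, ∃ V ∈ 𝓝 (0 : G), ∀ᶠ w in W, ∀ z ∈ V,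
      t w 0 - t w z ≤ ε := by
    intro ε hε
    obtain ⟨φ, hφ⟩ := exists_lt_of_lt_ciSup (show M - ε / 12 < ⨆ φ, m φ by
      simp only [M]; linarith)
    have hρ := φ.2.autocorrelation
    have h1 : Filter.Tendsto (fun p : G × G => p.1 - p.2) (𝓝 (0, 0)) (𝓝 0) := by
      have h2 : Continuous fun p : G × G => p.1 - p.2 := by fun_prop
      simpa using h2.tendsto (0, 0)
    have h2 := ((tendsto_translationDistance (μ := μ) hρ.continuous
      hρ.hasCompactSupport).comp h1).eventually_lt_const (show 0 < ε / 6 by positivity)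
    rw [nhds_prod_eq] at h2
    obtain ⟨V, hV, hVV⟩ := Filter.mem_prod_self_iff.mp h2
    refine ⟨V, hV, hW ?_⟩
    filter_upwards [h𝒱 V hV] with ψ hψ
    have hmψ : m ψ < M + ε / 6 := by
      have : m ψ ≤ M := le_ciSup hbdd ψ
      linarith
    filter_upwards [(hm ψ).eventually_lt_const hmψ, (hm φ).eventually_const_lt hφ]
      with n hn1 hn2 z hz
    refine (smoothing_zero_sub_le (hf n) (hfc n) (hf0 n) φ.2 ψ.2 hn1.le
      (show M - ε / 6 ≤ s φ n 0 by linarith) fun t ht => ?_).trans_eq (by ring)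
    exact (hVV (Set.mk_mem_prod hz (hψ ht))).le
  obtain ⟨F, hFc, hFp, hF0, hFlim⟩ := exists_isRealPosDef_limit W (g := t)
    (fun w => hsp _ _) (fun w => (le_abs_self _).trans (hs1 _ _ _)) heq
  refine ⟨F, hFc, hFp, hF0, fun h hh hhc => ?_⟩
  have hint : ∀ g : G → ℝ, Continuous g → Integrable (fun x => g x * h x) μ := fun g hg =>
    (hg.mul hh).integrable_of_hasCompactSupport hhc.mul_left
  have hhint : Integrable (fun x => |h x|) μ := (hh.integrable_of_hasCompactSupport hhc).abs
  have habs : ∀ (g k : G → ℝ) (ε : ℝ), (∀ x ∈ tsupport h, |g x - k x| ≤ ε) → Continuous g →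
      Continuous k → |∫ x, g x * h x ∂μ - ∫ x, k x * h x ∂μ| ≤ ε * ∫ x, |h x| ∂μ := by
    intro g k ε hgk hg hk
    rw [← integral_sub (hint g hg) (hint k hk), ← integral_const_mul, ← Real.norm_eq_abs]
    refine norm_integral_le_of_norm_le (hhint.const_mul ε) (.of_forall fun x => ?_)
    rw [← sub_mul, norm_mul, Real.norm_eq_abs, Real.norm_eq_abs]
    by_cases hx : x ∈ tsupport h
    · exact mul_le_mul_of_nonneg_right (hgk x hx) (abs_nonneg _)
    · simp [image_eq_zero_of_notMem_tsupport hx]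
  obtain ⟨L, hL⟩ := U.exists_tendsto_of_abs_le (u := fun n => ∫ x, f n x * h x ∂μ)
    (C := 1 * ∫ x, |h x| ∂μ) fun n => by
      have := habs (f n) 0 1 (fun x _ => by simpa using hf1 n x) (hfc n) continuous_zero
      simpa using this
  suffices hLF : ∫ x, F x * h x ∂μ = L by rwa [hLF]
  -- Three comparisons of size `ε / 3`: the tested sequence with its limit `L`, the sequence with
  -- its smoothings (the even mollifier is moved onto `h`), and the smoothings with `F`.
  refine eq_of_forall_dist_le fun ε hε => ?_
  have hC : 0 ≤ ∫ x, |h x| ∂μ := integral_nonneg fun x => abs_nonneg _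
  obtain ⟨V, hV, hVs⟩ := exists_nhds_integral_abs_smoothing_sub_le (μ := μ) hh hhc
    (show 0 < ε / 3 by positivity)
  have e1 : ∀ᶠ w in (W : Filter ({φ : G → ℝ // IsMollifier μ φ} × ι)),
      |∫ x, f w.2 x * h x ∂μ - L| < ε / 3 := hW (.of_forall fun φ => by
    have := Metric.tendsto_nhds.mp hL (ε / 3) (by positivity)
    simpa only [Real.dist_eq] using this)
  have e2 : ∀ᶠ w in (W : Filter ({φ : G → ℝ // IsMollifier μ φ} × ι)),
      |∫ x, s w.1 w.2 x * h x ∂μ - ∫ x, f w.2 x * h x ∂μ| ≤ ε / 3 := by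
    refine hW ((h𝒱 V hV).mono fun φ hφ => .of_forall fun n => ?_)
    have hρ := φ.2.autocorrelation
    refine le_trans ?_ (hVs _ hρ hφ)
    have hsm := continuous_smoothing (μ := μ) hρ.continuous hρ.hasCompactSupport hh
    have hsmc := hasCompactSupport_smoothing (μ := μ) hρ.hasCompactSupport hhc
    have hi : Integrable (fun x => f n x * smoothing μ (autocorrelation μ φ.1) h x) μ :=
      ((hfc n).mul hsm).integrable_of_hasCompactSupport hsmc.mul_left
    simp only [s]
    rw [integral_smoothing_mul hρ.continuous hρ.hasCompactSupport
      (isRealPosDef_autocorrelation φ.2).1 (hfc n) hh hhc,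
      ← integral_sub hi (hint _ (hfc n)), ← Real.norm_eq_abs]
    refine norm_integral_le_of_norm_le ((hsm.sub hh).integrable_of_hasCompactSupport
      (hsmc.sub hhc)).abs (.of_forall fun x => ?_)
    rw [← mul_sub, norm_mul, Real.norm_eq_abs, Real.norm_eq_abs]
    exact mul_le_of_le_one_left (abs_nonneg _) (hf1 n x)
  have e3 : ∀ᶠ w in (W : Filter ({φ : G → ℝ // IsMollifier μ φ} × ι)),
      |∫ x, s w.1 w.2 x * h x ∂μ - ∫ x, F x * h x ∂μ| ≤ ε / 3 := by
    refine (hFlim _ hhc (ε / 3 / (1 + ∫ x, |h x| ∂μ)) (by positivity)).mono fun w hw => ?_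
    refine (habs _ _ _ hw (hsc _ _) hFc).trans ?_
    rw [div_mul_eq_mul_div, div_le_iff₀ (by positivity)]
    exact mul_le_mul_of_nonneg_left (by linarith) (by positivity)
  obtain ⟨w, hw1, hw2, hw3⟩ := (e1.and (e2.and e3)).exists
  rw [Real.dist_eq]
  have a1 := abs_lt.mp hw1
  have a2 := abs_le.mp hw2
  have a3 := abs_le.mp hw3
  exact abs_le.mpr ⟨by linarith, by linarith⟩

end

/-! ### Passing signs, integrability and integrals to the limit -/

/-- A weak limit inherits its sign only on the open exterior; this inclusion lets continuity carry
the sign to the whole complement. -/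
theorem BoundaryCoherent.compl_subset {X : Type*} [TopologicalSpace X] {Ω : Set X}
    (h : BoundaryCoherent Ω) : Ωᶜ ⊆ closure (closure Ω)ᶜ := by
  intro x hx
  by_cases hx' : x ∈ closure Ω
  · exact h ⟨hx', fun hi => hx (interior_subset hi)⟩
  · exact subset_closure hx'

section

variable {G : Type*} [AddCommGroup G] [TopologicalSpace G] [IsTopologicalAddGroup G]
  [LocallyCompactSpace G] [T2Space G] [MeasurableSpace G] [BorelSpace G]
  {μ : Measure G} [μ.IsAddHaarMeasure] [μ.Regular]

/-- A continuous function with values in `[0, 1]` is integrable if its integrals against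
compactly supported continuous functions with values in `[0, 1]` are bounded. -/
theorem integrable_of_integral_mul_le {k : G → ℝ} (hk : Continuous k) (hk0 : ∀ x, 0 ≤ k x)
    (hk1 : ∀ x, k x ≤ 1) {B : ℝ}
    (hB : ∀ h : G → ℝ, Continuous h → HasCompactSupport h → (∀ x, 0 ≤ h x) → (∀ x, h x ≤ 1) →
      ∫ x, k x * h x ∂μ ≤ B) : Integrable k μ := by
  have hcompact : ∀ K, IsCompact K → ∫⁻ x in K, ENNReal.ofReal (k x) ∂μ ≤ ENNReal.ofReal B := by
    intro K hK
    obtain ⟨h, hh1, -, hhc, hh⟩ := exists_continuous_one_zero_of_isCompact hK isClosed_empty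
      (Set.disjoint_empty K)
    have hint : Integrable (fun x => k x * h x) μ :=
      (hk.mul h.continuous).integrable_of_hasCompactSupport hhc.mul_left
    calc ∫⁻ x in K, ENNReal.ofReal (k x) ∂μ
        = ∫⁻ x in K, ENNReal.ofReal (k x * h x) ∂μ :=
          setLIntegral_congr_fun hK.measurableSet fun x hx => by simp [hh1 hx]
      _ ≤ ∫⁻ x, ENNReal.ofReal (k x * h x) ∂μ := setLIntegral_le_lintegral _ _
      _ = ENNReal.ofReal (∫ x, k x * h x ∂μ) :=
          (ofReal_integral_eq_lintegral_ofReal hint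
            (.of_forall fun x => mul_nonneg (hk0 x) (hh x).1)).symm
      _ ≤ ENNReal.ofReal B := ENNReal.ofReal_le_ofReal
          (hB h h.continuous hhc (fun x => (hh x).1) fun x => (hh x).2)
  -- These open sets exhaust the support of `k`. A Markov estimate on compact subsets shows that
  -- each has finite measure, so regularity transfers the bound from compact sets to `S m` without
  -- σ-finiteness of `μ`.
  let S : ℕ → Set G := fun m => {x | 1 / ((m : ℝ) + 1) < k x}
  have hSo : ∀ m, IsOpen (S m) := fun m => isOpen_lt continuous_const hk
  have hSfin : ∀ m, μ (S m) < ⊤ := by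
    intro m
    have hm : (0 : ℝ) < 1 / ((m : ℝ) + 1) := by positivity
    have h0 : ENNReal.ofReal (1 / ((m : ℝ) + 1)) ≠ 0 := by simpa using hm
    refine lt_of_le_of_lt (b := ENNReal.ofReal B / ENNReal.ofReal (1 / ((m : ℝ) + 1))) ?_
      (ENNReal.div_lt_top ENNReal.ofReal_ne_top h0)
    rw [(hSo m).measure_eq_iSup_isCompact]
    refine iSup₂_le fun K hKS => iSup_le fun hK => ?_
    rw [ENNReal.le_div_iff_mul_le (Or.inl h0) (Or.inl ENNReal.ofReal_ne_top), mul_comm,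
      ← setLIntegral_const]
    refine le_trans ?_ (hcompact K hK)
    exact setLIntegral_mono' hK.measurableSet fun x hx => ENNReal.ofReal_le_ofReal (hKS hx).le
  have hS : ∀ m, ∫⁻ x in S m, ENNReal.ofReal (k x) ∂μ ≤ ENNReal.ofReal B := by
    intro m
    refine ENNReal.le_of_forall_pos_le_add fun ε hε _ => ?_
    obtain ⟨K, hKS, hK, hKε⟩ := (hSo m).measurableSet.exists_isCompact_sdiff_lt (hSfin m).ne
      (ENNReal.coe_ne_zero.mpr hε.ne')
    rw [← Set.union_sdiff_cancel hKS]
    refine (lintegral_union_le _ _ _).trans (add_le_add (hcompact K hK) ?_)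
    calc ∫⁻ x in S m \ K, ENNReal.ofReal (k x) ∂μ ≤ ∫⁻ _ in S m \ K, 1 ∂μ :=
          lintegral_mono fun x => by simpa using hk1 x
      _ ≤ ε := by simpa using hKε.le
  have hSU : ∫⁻ x, ENNReal.ofReal (k x) ∂μ = ∫⁻ x in ⋃ m, S m, ENNReal.ofReal (k x) ∂μ := by
    refine (setLIntegral_eq_of_support_subset ?_).symm
    intro x hx
    have hx' : 0 < k x := by simpa using hx
    obtain ⟨m, hm⟩ := exists_nat_one_div_lt hx'
    exact Set.mem_iUnion.mpr ⟨m, hm⟩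
  have hmono : Monotone S := by
    intro m n hmn x hx
    refine lt_of_le_of_lt (b := 1 / ((m : ℝ) + 1)) ?_ hx
    exact one_div_le_one_div_of_le (by positivity) (by gcongr)
  refine ⟨hk.aestronglyMeasurable, ?_⟩
  rw [hasFiniteIntegral_iff_ofReal (.of_forall hk0), hSU,
    setLIntegral_iUnion_of_directed _ hmono.directed_le]
  exact lt_of_le_of_lt (iSup_le hS) ENNReal.ofReal_lt_top

/-- Almost all the mass lies on a superlevel set of finite measure, and `|F| ≤ 1` makes replacing it
by a large compact subset cheap. -/
theorem exists_isCompact_setIntegral_compl_abs_le {F : G → ℝ} (hF : Continuous F)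
    (hF1 : ∀ x, |F x| ≤ 1) (hint : Integrable F μ) {ε : ℝ} (hε : 0 < ε) :
    ∃ K, IsCompact K ∧ ∫ x in Kᶜ, |F x| ∂μ ≤ ε := by
  let S : ℕ → Set G := fun m => {x | 1 / ((m : ℝ) + 1) < |F x|}
  have hSo : ∀ m, IsOpen (S m) := fun m => isOpen_lt continuous_const hF.abs
  have hmono : Monotone S := by
    intro m n hmn x hx
    refine lt_of_le_of_lt (b := 1 / ((m : ℝ) + 1)) ?_ hx
    exact one_div_le_one_div_of_le (by positivity) (by gcongr)
  have hSU : ∫ x in ⋃ m, S m, |F x| ∂μ = ∫ x, |F x| ∂μ := by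
    refine setIntegral_eq_integral_of_forall_compl_eq_zero fun x hx => ?_
    by_contra hx'
    obtain ⟨m, hm⟩ := exists_nat_one_div_lt (lt_of_le_of_ne (abs_nonneg (F x)) (Ne.symm hx'))
    exact hx (Set.mem_iUnion.mpr ⟨m, hm⟩)
  have hlim := tendsto_setIntegral_of_monotone (fun m => (hSo m).measurableSet) hmono
    (hint.abs.integrableOn (s := ⋃ m, S m))
  rw [hSU] at hlim
  obtain ⟨m, hm⟩ := (hlim.eventually_const_lt
    (show ∫ x, |F x| ∂μ - ε / 2 < ∫ x, |F x| ∂μ by linarith)).exists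
  have hfin : μ (S m) < ⊤ := hint.measure_norm_gt_lt_top (by positivity)
  obtain ⟨K, hKS, hK, hKε⟩ := (hSo m).measurableSet.exists_isCompact_sdiff_lt hfin.ne
    (ε := ENNReal.ofReal (ε / 2)) (by simpa using hε)
  refine ⟨K, hK, ?_⟩
  have h1 := integral_add_compl hK.measurableSet hint.abs
  have h2 := setIntegral_sdiff hK.measurableSet (hint.abs.integrableOn (s := S m)) hKS
  have h3 : ∫ x in S m \ K, |F x| ∂μ ≤ ε / 2 := by
    have h4 : ‖∫ x in S m \ K, |F x| ∂μ‖ ≤ 1 * μ.real (S m \ K) :=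
      norm_setIntegral_le_of_norm_le_const
        ((measure_mono Set.sdiff_subset).trans_lt hfin) fun x _ => by simpa using hF1 x
    rw [one_mul] at h4
    exact (le_abs_self _).trans
      (h4.trans (ENNReal.toReal_le_of_le_ofReal (by positivity) hKε.le))
  linarith

/-- A weak limit of functions that are nonpositive on an open set is nonpositive on that set. -/
theorem nonpos_of_tendsto_integral_mul {ι : Type*} {l : Filter ι} [l.NeBot] {f : ι → G → ℝ}
    {F : G → ℝ} (hF : Continuous F)
    (hlim : ∀ h : G → ℝ, Continuous h → HasCompactSupport h →
      Filter.Tendsto (fun n => ∫ x, f n x * h x ∂μ) l (𝓝 (∫ x, F x * h x ∂μ)))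
    {O : Set G} (hO : IsOpen O) (hf : ∀ n, ∀ x ∈ O, f n x ≤ 0) : ∀ x ∈ O, F x ≤ 0 := by
  intro x hx
  by_contra! hFx
  have hV : IsOpen ({y | 0 < F y} ∩ O) := (isOpen_lt continuous_const hF).inter hO
  obtain ⟨h, hh1, hh0, hhc, hh⟩ := exists_continuous_one_zero_of_isCompact
    (isCompact_singleton (x := x)) hV.isClosed_compl
    (Set.disjoint_singleton_left.mpr fun h => h ⟨hFx, hx⟩)
  have hx1 : h x = 1 := hh1 rfl
  have hzero : ∀ y, y ∉ {y | 0 < F y} ∩ O → h y = 0 := fun y hy => hh0 hy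
  have hpos : 0 < ∫ y, F y * h y ∂μ := by
    refine (hF.mul h.continuous).integral_pos_of_hasCompactSupport_nonneg_nonzero hhc.mul_left
      (x := x) (fun y => ?_) (by simpa [hx1] using hFx.ne')
    by_cases hy : y ∈ {y | 0 < F y} ∩ O
    · exact mul_nonneg hy.1.le (hh y).1
    · simp [hzero y hy]
  refine hpos.not_ge (le_of_tendsto' (hlim h h.continuous hhc) fun n =>
    integral_nonpos fun y => ?_)
  by_cases hy : y ∈ {y | 0 < F y} ∩ O
  · exact mul_nonpos_of_nonpos_of_nonneg (hf n y hy.2) (hh y).1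
  · simp [hzero y hy]

variable {Ωp Ωm : Set G}

theorem isRealPosDef_of_mem_posDefOne {f : G → ℝ} (hf : f ∈ posDefOne G) : IsRealPosDef f :=
  hf.2.1.isRealPosDef

theorem le_one_of_mem_posDefOne {f : G → ℝ} (hf : f ∈ posDefOne G) (x : G) : f x ≤ 1 :=
  (le_abs_self _).trans (((isRealPosDef_of_mem_posDefOne hf).abs_le_apply_zero x).trans_eq hf.2.2)

/-- Testing a function of the extremal class against a function that is `1` on `K` loses at most
the measure of `interior Ωp \ K`. -/
theorem integral_sub_le_integral_mul {f h : G → ℝ} (hf : f ∈ extremalClass μ Ωp Ωm)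
    (hp_fin : μ Ωp < ⊤) (hh : Continuous h) (hh0 : ∀ x, 0 ≤ h x) (hh1 : ∀ x, h x ≤ 1)
    {K : Set G} (hK : MeasurableSet K) (hhK : ∀ x ∈ K, h x = 1) :
    ∫ x, f x ∂μ - μ.real (interior Ωp \ K) ≤ ∫ x, f x * h x ∂μ := by
  obtain ⟨hfp, hfi, hfΩ, -⟩ := hf
  have hfh : Integrable (fun x => f x * h x) μ :=
    hfi.mul_bdd (c := 1) hh.aestronglyMeasurable
      (.of_forall fun x => by rw [Real.norm_eq_abs, abs_of_nonneg (hh0 x)]; exact hh1 x)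
  have hm : MeasurableSet (interior Ωp \ K) := isOpen_interior.measurableSet.diff hK
  have hfin : μ (interior Ωp \ K) ≠ ⊤ :=
    ((measure_mono (Set.sdiff_subset.trans interior_subset)).trans_lt hp_fin).ne
  rw [sub_le_iff_le_add, ← sub_le_iff_le_add', ← integral_sub hfi hfh,
    ← integral_indicator_one hm]
  refine integral_mono (hfi.sub hfh) ((integrable_indicator_iff hm).mpr
    (integrableOn_const hfin)) fun x => ?_
  -- The positivity set is open, so the measurable set `interior Ωp` can stand in for `Ωp`.
  have hfO : {x | 0 < f x} ⊆ interior Ωp :=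
    interior_maximal hfΩ (isOpen_lt continuous_const hfp.1)
  by_cases hx : x ∈ interior Ωp \ K
  · rw [Set.indicator_of_mem hx, Pi.one_apply]
    nlinarith [hh0 x, hh1 x, le_one_of_mem_posDefOne hfp x]
  · rw [Set.indicator_of_notMem hx]
    by_cases hxK : x ∈ K
    · simp [hhK x hxK]
    · have : f x ≤ 0 := not_lt.mp fun h => hx ⟨hfO h, hxK⟩
      nlinarith [hh0 x, hh1 x]

theorem integral_le_measureReal {f : G → ℝ} (hf : f ∈ extremalClass μ Ωp Ωm)
    (hp_fin : μ Ωp < ⊤) : ∫ x, f x ∂μ ≤ μ.real (interior Ωp) := by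
  have h := integral_sub_le_integral_mul hf hp_fin (h := fun _ => 0) continuous_const
    (fun _ => le_rfl) (fun _ => zero_le_one) MeasurableSet.empty (by simp)
  simpa using h

theorem bddAbove_integral_extremalClass (hp_fin : μ Ωp < ⊤) :
    BddAbove ((fun f : G → ℝ => ∫ x, f x ∂μ) '' extremalClass μ Ωp Ωm) := by
  refine ⟨μ.real (interior Ωp), ?_⟩
  rintro _ ⟨f, hf, rfl⟩
  exact integral_le_measureReal hf hp_fin

/-- A normalised autocorrelation supported in `Ωp` is nonnegative, so it belongs to the class
whatever `Ωm` is. -/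
theorem exists_mem_extremalClass_integral_pos (hp_nhds : Ωp ∈ 𝓝 (0 : G)) :
    ∃ f ∈ extremalClass μ Ωp Ωm, 0 < ∫ x, f x ∂μ := by
  obtain ⟨φ, hφ, hφV⟩ := exists_isMollifier_support_autocorrelation_subset μ hp_nhds
  have hρ := hφ.autocorrelation
  have h0 := autocorrelation_zero_pos hφ
  have hi : 0 < (autocorrelation μ φ 0)⁻¹ := inv_pos.mpr h0
  refine ⟨fun x => (autocorrelation μ φ 0)⁻¹ * autocorrelation μ φ x,
    ⟨⟨hρ.continuous.const_mul _, ((isRealPosDef_autocorrelation hφ).const_mul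
      hi.le).isPositiveDefinite, inv_mul_cancel₀ h0.ne'⟩,
      (hρ.continuous.integrable_of_hasCompactSupport hρ.hasCompactSupport).const_mul _,
      fun x hx => hφV fun hx' => ?_, fun x hx => ?_⟩, ?_⟩
  · simp [hx'] at hx
  · exact absurd hx (mul_nonneg hi.le (hρ.nonneg x)).not_gt
  · rw [integral_const_mul, hρ.integral_eq_one, mul_one]
    exact hi

/-- The extremal value is attained up to normalisation by a continuous positive definite function
with value at most `1` at `0`. -/
theorem exists_integral_ge_extremalValue (hp_coh : BoundaryCoherent Ωp)
    (hm_coh : BoundaryCoherent Ωm) (hp_fin : μ Ωp < ⊤)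
    (hne : (extremalClass μ Ωp Ωm).Nonempty) :
    ∃ F : G → ℝ, Continuous F ∧ IsRealPosDef F ∧ F 0 ≤ 1 ∧ Integrable F μ ∧
      {x | 0 < F x} ⊆ Ωp ∧ {x | F x < 0} ⊆ Ωm ∧ extremalValue μ Ωp Ωm ≤ ∫ x, F x ∂μ := by
  set C := extremalValue μ Ωp Ωm with hC
  have hseq : ∀ n : ℕ, ∃ f ∈ extremalClass μ Ωp Ωm, C - 1 / ((n : ℝ) + 1) < ∫ x, f x ∂μ := by
    intro n
    have h1 : C - 1 / ((n : ℝ) + 1) < extremalValue μ Ωp Ωm :=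
      sub_lt_self _ (by positivity)
    obtain ⟨_, ⟨f, hf, rfl⟩, hlt⟩ := exists_lt_of_lt_csSup (hne.image _) h1
    exact ⟨f, hf, hlt⟩
  choose f hf hfC using hseq
  obtain ⟨F, hFc, hFp, hF0, hlim⟩ := exists_isRealPosDef_weak_limit μ (Filter.hyperfilter ℕ)
    (fun n => isRealPosDef_of_mem_posDefOne (hf n).1) (fun n => (hf n).1.1)
    (fun n => (hf n).1.2.2)
  have hF1 : ∀ x, |F x| ≤ 1 := fun x => (hFp.abs_le_apply_zero x).trans hF0
  have hFΩp : {x | 0 < F x} ⊆ Ωp := by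
    intro x hx
    by_contra hxΩ
    have h1 := nonpos_of_tendsto_integral_mul hFc hlim (isClosed_closure (s := Ωp)).isOpen_compl
      fun n y hy => not_lt.mp fun h => hy (subset_closure ((hf n).2.2.1 h))
    have h2 : closure (closure Ωp)ᶜ ⊆ {y | F y ≤ 0} :=
      closure_minimal h1 (isClosed_le hFc continuous_const)
    have h3 : F x ≤ 0 := h2 (hp_coh.compl_subset hxΩ)
    exact h3.not_gt hx
  have hFΩm : {x | F x < 0} ⊆ Ωm := by
    intro x hx
    by_contra hxΩ
    have h1 := nonpos_of_tendsto_integral_mul (μ := μ) (l := Filter.hyperfilter ℕ)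
      (f := fun n x => -f n x) (F := fun x => -F x) hFc.neg
      (fun h hh hhc => by simpa only [neg_mul, integral_neg] using (hlim h hh hhc).neg)
      (isClosed_closure (s := Ωm)).isOpen_compl
      fun n y hy => by
        have : 0 ≤ f n y := not_lt.mp fun h => hy (subset_closure ((hf n).2.2.2 h))
        linarith
    have h2 : closure (closure Ωm)ᶜ ⊆ {y | -F y ≤ 0} :=
      closure_minimal h1 (isClosed_le hFc.neg continuous_const)
    have h3 : -F x ≤ 0 := h2 (hm_coh.compl_subset hxΩ)
    have h4 : F x < 0 := hx
    linarith
  have hge : ∀ h : G → ℝ, Continuous h → HasCompactSupport h → (∀ x, 0 ≤ h x) →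
      (∀ x, h x ≤ 1) → ∀ K, MeasurableSet K → (∀ x ∈ K, h x = 1) →
      C - μ.real (interior Ωp \ K) ≤ ∫ x, F x * h x ∂μ := by
    intro h hh hhc hh0 hh1 K hK hhK
    have h1 : Filter.Tendsto (fun n : ℕ => C - 1 / ((n : ℝ) + 1) - μ.real (interior Ωp \ K))
        (Filter.hyperfilter ℕ) (𝓝 (C - 0 - μ.real (interior Ωp \ K))) :=
      ((tendsto_one_div_add_atTop_nhds_zero_nat.mono_left Nat.hyperfilter_le_atTop).const_sub
        C).sub_const _
    rw [sub_zero] at h1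
    refine le_of_tendsto_of_tendsto' h1 (hlim h hh hhc) fun n => ?_
    have := integral_sub_le_integral_mul (hf n) hp_fin hh hh0 hh1 hK hhK
    linarith [hfC n]
  have hPm : MeasurableSet (interior Ωp) := isOpen_interior.measurableSet
  have hPfin : μ (interior Ωp) ≠ ⊤ := ((measure_mono interior_subset).trans_lt hp_fin).ne
  have hFO : {x | 0 < F x} ⊆ interior Ωp :=
    interior_maximal hFΩp (isOpen_lt continuous_const hFc)
  have hFpos : Integrable (fun x => max (F x) 0) μ := by
    refine Integrable.mono' (g := (interior Ωp).indicator 1)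
      ((integrable_indicator_iff hPm).mpr (integrableOn_const hPfin))
      (hFc.max continuous_const).aestronglyMeasurable (.of_forall fun x => ?_)
    rw [Real.norm_eq_abs, abs_of_nonneg (le_max_right _ _)]
    by_cases hx : x ∈ interior Ωp
    · rw [Set.indicator_of_mem hx]
      exact max_le (abs_le.mp (hF1 x)).2 zero_le_one
    · rw [Set.indicator_of_notMem hx]
      exact max_le (not_lt.mp fun h => hx (hFO h)) le_rfl
  have hFneg : Integrable (fun x => max (-F x) 0) μ := by
    refine integrable_of_integral_mul_le (hFc.neg.max continuous_const)
      (fun x => le_max_right _ _)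
      (fun x => max_le (by linarith [(abs_le.mp (hF1 x)).1]) zero_le_one)
      -- The bound comes from `hge` with `K = ∅`: a very negative tested integral of `F` would
      -- contradict the lower bound `C - μ.real (interior Ωp)`.
      (B := ∫ x, max (F x) 0 ∂μ - (C - μ.real (interior Ωp)))
      fun h hh hhc hh0 hh1 => ?_
    have h1 := hge h hh hhc hh0 hh1 ∅ MeasurableSet.empty (by simp)
    rw [Set.sdiff_empty] at h1
    have hi1 : Integrable (fun x => max (F x) 0 * h x) μ :=
      ((hFc.max continuous_const).mul hh).integrable_of_hasCompactSupport hhc.mul_left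
    have hi2 : Integrable (fun x => F x * h x) μ :=
      (hFc.mul hh).integrable_of_hasCompactSupport hhc.mul_left
    have h2 : ∫ x, max (-F x) 0 * h x ∂μ = ∫ x, max (F x) 0 * h x ∂μ - ∫ x, F x * h x ∂μ := by
      rw [← integral_sub hi1 hi2]
      refine integral_congr_ae (.of_forall fun x => ?_)
      simp only
      rcases le_total (F x) 0 with h | h
      · rw [max_eq_left (neg_nonneg.mpr h), max_eq_right h]
        ring
      · rw [max_eq_right (neg_nonpos.mpr h), max_eq_left h]
        ring
    have h3 : ∫ x, max (F x) 0 * h x ∂μ ≤ ∫ x, max (F x) 0 ∂μ :=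
      integral_mono hi1 hFpos fun x => mul_le_of_le_one_right (le_max_right _ _) (hh1 x)
    linarith
  have hFint : Integrable F μ := by
    refine (hFpos.sub hFneg).congr (.of_forall fun x => ?_)
    simp only [Pi.sub_apply]
    rcases le_total (F x) 0 with h | h
    · rw [max_eq_left (neg_nonneg.mpr h), max_eq_right h]
      ring
    · rw [max_eq_right (neg_nonpos.mpr h), max_eq_left h]
      ring
  refine ⟨F, hFc, hFp, hF0, hFint, hFΩp, hFΩm, le_of_forall_pos_le_add fun ε hε => ?_⟩
  -- `K` controls the loss of positive mass along the sequence and `L` the tail of `F`; the cutoff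
  -- `h` is `1` on both.
  obtain ⟨K, hKP, hK, hKε⟩ := hPm.exists_isCompact_sdiff_lt hPfin
    (ε := ENNReal.ofReal (ε / 2)) (by simpa using hε)
  obtain ⟨L, hL, hLε⟩ :=
    exists_isCompact_setIntegral_compl_abs_le hFc hF1 hFint (show 0 < ε / 2 by positivity)
  obtain ⟨h, hh1, -, hhc, hh⟩ := exists_continuous_one_zero_of_isCompact
    (hK.union hL) isClosed_empty (Set.disjoint_empty _)
  have h1 := hge h h.continuous hhc (fun x => (hh x).1) (fun x => (hh x).2) K hK.measurableSet
    fun x hx => hh1 (Or.inl hx)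
  have h2 : μ.real (interior Ωp \ K) ≤ ε / 2 :=
    ENNReal.toReal_le_of_le_ofReal (by positivity) hKε.le
  have hi : Integrable (fun x => F x * h x) μ :=
    (hFc.mul h.continuous).integrable_of_hasCompactSupport hhc.mul_left
  have h3 : |∫ x, F x ∂μ - ∫ x, F x * h x ∂μ| ≤ ε / 2 := by
    rw [← integral_indicator hL.measurableSet.compl] at hLε
    rw [← integral_sub hFint hi, ← Real.norm_eq_abs]
    refine (norm_integral_le_of_norm_le (hFint.abs.indicator hL.measurableSet.compl)
      (.of_forall fun x => ?_)).trans hLε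
    by_cases hx : x ∈ L
    · have : h x = 1 := hh1 (Or.inr hx)
      simp [this, hx]
    · rw [Set.indicator_of_mem (Set.mem_compl hx), Real.norm_eq_abs, ← mul_one_sub, abs_mul]
      refine mul_le_of_le_one_right (abs_nonneg _) (abs_le.mpr ⟨?_, ?_⟩) <;>
        linarith [(hh x).1, (hh x).2]
  linarith [(abs_le.mp h3).1]

end

/-! ### Normalising the limit -/

theorem mainTheorem1 {G : Type*} [AddCommGroup G] [TopologicalSpace G] [IsTopologicalAddGroup G]
    [LocallyCompactSpace G] [T2Space G] [MeasurableSpace G] [BorelSpace G]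
    (μ : Measure G) [μ.IsAddHaarMeasure] [μ.Regular]
    (Ωp Ωm : Set G)
    (hp_symm : ∀ x, x ∈ Ωp → -x ∈ Ωp) (hm_symm : ∀ x, x ∈ Ωm → -x ∈ Ωm)
    (hp_coh : BoundaryCoherent Ωp) (hm_coh : BoundaryCoherent Ωm)
    (hp_nhds : Ωp ∈ 𝓝 (0 : G)) (hp_fin : μ Ωp < ⊤) :
    BddAbove ((fun f : G → ℝ => ∫ x, f x ∂μ) '' extremalClass μ Ωp Ωm) ∧
      ∃ f ∈ extremalClass μ Ωp Ωm, ∫ x, f x ∂μ = extremalValue μ Ωp Ωm := by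
  have hbdd := bddAbove_integral_extremalClass (μ := μ) (Ωp := Ωp) (Ωm := Ωm) hp_fin
  obtain ⟨f₀, hf₀, hpos⟩ := exists_mem_extremalClass_integral_pos (μ := μ) (Ωm := Ωm) hp_nhds
  -- Positivity rules out the zero limit, and later makes division by `F 0 ≤ 1` go in the right
  -- direction.
  have hC : 0 < extremalValue μ Ωp Ωm := hpos.trans_le (le_csSup hbdd ⟨f₀, hf₀, rfl⟩)
  obtain ⟨F, hFc, hFp, hF0, hFi, hFΩp, hFΩm, hFC⟩ :=
    exists_integral_ge_extremalValue hp_coh hm_coh hp_fin ⟨f₀, hf₀⟩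
  have hF0pos : 0 < F 0 := by
    refine hFp.zero_nonneg.lt_of_ne fun h => ?_
    have hF : ∀ x, F x = 0 := fun x =>
      abs_nonpos_iff.mp ((hFp.abs_le_apply_zero x).trans_eq h.symm)
    simp only [hF, integral_zero] at hFC
    exact hFC.not_gt hC
  have hi : 0 < (F 0)⁻¹ := inv_pos.mpr hF0pos
  have hmem : (fun x => (F 0)⁻¹ * F x) ∈ extremalClass μ Ωp Ωm :=
    ⟨⟨hFc.const_mul _, (hFp.const_mul hi.le).isPositiveDefinite, inv_mul_cancel₀ hF0pos.ne'⟩,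
      hFi.const_mul _, fun x hx => hFΩp (pos_of_mul_pos_right hx hi.le),
      fun x hx => hFΩm (neg_of_mul_neg_right hx hi.le)⟩
  refine ⟨hbdd, _, hmem, le_antisymm (le_csSup hbdd ⟨_, hmem, rfl⟩) ?_⟩
  rw [integral_const_mul]
  exact hFC.trans (le_mul_of_one_le_left (hC.le.trans hFC) ((one_le_inv₀ hF0pos).mpr hF0))
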